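/- Consider the faces (unit equilateral triangles) of the triangular lattice in the plane. A \emph{polyiamond} is a nonempty finite set $P$ of faces that is connected through shared edges (holes are allowed). Its area $\|P\|$ is the number of its faces; its edge-perimeter $p(P)$ is the number of lattice edges that separate a face of $P$ from a face not in $P$; its site-perimeter $s(P)$ is the number of faces not in $P$ that share at least one edge with $P$. For $r\ge 1$ let $E(r)=E_{B_0}(r)$ be the regular lattice hexagon of side length $r$, and let the bar $B(l)$ be the trapezoid of $2l-1$ faces that is the difference of the lattice triangles of side lengths $l$ and $l-1$ sharing a corner. For $1\le i\le 5$, $E_{B_i}(r)$ is obtained by attaching bars along their larger bases to $i$ successive sides of $E(r)$, in cyclic order: the first bar is $B(r)$, and each of the others is a $B(r+1)$ that fits exactly the next side, which the preceding bar has lengthened to $r+1$. (Attaching a sixth bar $B(r+2)$ would yield $E(r+1)$.) A \emph{quasi-regular hexagon} is any translate, by a lattice vector, of any rotation by a multiple of $\pi/3$ of some $E_{B_i}(r)$ with $r\ge1$, $0\le i\le 5$; $\mathcal Q$ is the set of all of them. \textbf{Lemma.} Let $E\in\mathcal Q$. If $P\notin\mathcal Q$ is a polyiamond with $\|P\|\ge\|E\|$,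 then $p(P)>p(E)$ and $s(P)>s(E)$. Consequently $E$ is, up to lattice translations and rotations by multiples of $\pi/3$, the unique minimizer of $p$, and the unique minimizer of $s$, among polyiamonds of its area: $E$ is a polyiamond, and every polyiamond $P$ with $\|P\|=\|E\|$ satisfies $p(P)\ge p(E)$ and $s(P)\ge s(E)$, where equality holds in either inequality if and only if $P$ is obtained from $E$ by such a rotation and translation. -/

import Mathlib

namespace Polyiamond

/-- Vertices of the triangular lattice: `(x, y)` is the point `x + y ω` of the plane, where
`ω = exp (i π / 3)`. The six neighbours of the origin are `±(1, 0)`, `±(0, 1)`, `±(1, -1)`. -/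
abbrev Vertex : Type := ℤ × ℤ

/-- Faces (unit triangles) of the triangular lattice: `((x, y), true)` is the upward triangle whose
lower left vertex is `(x, y)`, and `((x, y), false)` is the downward triangle which together with
it forms the rhombus `(x, y), (x + 1, y), (x + 1, y + 1), (x, y + 1)`. -/
abbrev Face : Type := (ℤ × ℤ) × Bool

/-- The three vertices of a face. -/
def vertices : Face → Finset Vertex
  | ((x, y), true) => {(x, y), (x + 1, y), (x, y + 1)}
  | ((x, y), false) => {(x + 1, y), (x, y + 1), (x + 1, y + 1)}

/-- The three unit edges of a face, as pairs of vertices. -/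
def edges (f : Face) : Finset (Finset Vertex) := (vertices f).powersetCard 2

/-- Two distinct faces are adjacent when they share an edge. -/
def faceGraph : SimpleGraph Face where
  Adj f g := f ≠ g ∧ ∃ e, e ∈ edges f ∧ e ∈ edges g
  symm := ⟨fun _ _ h => ⟨h.1.symm, h.2.imp fun _ he => ⟨he.2, he.1⟩⟩⟩
  loopless := ⟨fun _ h => h.1 rfl⟩

/-- A polyiamond: a (nonempty) finite edge-connected set of faces. It may have holes. -/
def IsPolyiamond (P : Finset Face) : Prop := (faceGraph.induce (P : Set Face)).Connected

/-- The area: the number of triangular units. -/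
def area (P : Finset Face) : ℕ := P.card

/-- The boundary: the unit edges that separate a face of `P` from a face outside `P`. -/
def boundary (P : Finset Face) : Set (Finset Vertex) :=
  {e | ∃ f ∈ P, ∃ g ∉ P, e ∈ edges f ∧ e ∈ edges g}

/-- The edge-perimeter: the number of boundary edges. -/
noncomputable def edgePerimeter (P : Finset Face) : ℕ := (boundary P).ncard

/-- The site-perimeter: the number of empty faces that share at least one edge with `P`. -/
noncomputable def sitePerimeter (P : Finset Face) : ℕ :=
  {g : Face | g ∉ P ∧ ∃ f ∈ P, faceGraph.Adj f g}.ncard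

/-- Translation of faces by a lattice vector. -/
def translate (v : Vertex) (f : Face) : Face := (f.1 + v, f.2)

/-- Rotation of vertices about the origin by `π / 3`: multiplication by `ω`, with `ω² = ω - 1`. -/
def rotateVertex (v : Vertex) : Vertex := (-v.2, v.1 + v.2)

/-- Rotation of faces about the origin by `π / 3`. -/
def rotate : Face → Face
  | ((x, y), true) => ((-y - 1, x + y), false)
  | ((x, y), false) => ((-y - 1, x + y + 1), true)

theorem vertices_translate (v : Vertex) (f : Face) :
    vertices (translate v f) = (vertices f).image (· + v) := by
  obtain ⟨⟨x, y⟩, b⟩ := f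
  obtain ⟨a, c⟩ := v
  cases b <;> ext ⟨p, q⟩ <;> simp [vertices, translate] <;> grind

theorem vertices_rotate (f : Face) : vertices (rotate f) = (vertices f).image rotateVertex := by
  obtain ⟨⟨x, y⟩, b⟩ := f
  cases b <;> ext ⟨p, q⟩ <;> simp [vertices, rotate, rotateVertex] <;> grind

/-- `Q` is obtained from `P` by a rotation by a multiple of `π / 3` and a translation. -/
def Congruent (P Q : Finset Face) : Prop :=
  ∃ (z : ℕ) (v : Vertex), Q = (P.image (rotate^[z])).image (translate v)

/-- The regular hexagon `E(r)` of radius (side length) `r` centred at the origin: all faces whose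
vertices are at lattice distance at most `r` from the origin. -/
noncomputable def regularHexagon (r : ℕ) : Finset Face :=
  ((Finset.Icc (-(r : ℤ)) r ×ˢ Finset.Icc (-(r : ℤ)) r) ×ˢ Finset.univ).filter fun f =>
    ∀ v ∈ vertices f, |v.1| ≤ (r : ℤ) ∧ |v.2| ≤ (r : ℤ) ∧ |v.1 + v.2| ≤ (r : ℤ)

/-- The equilateral triangle with vertices `(0, 0)`, `(l, 0)`, `(0, l)`. -/
noncomputable def triangle (l : ℕ) : Finset Face :=
  ((Finset.Icc (0 : ℤ) l ×ˢ Finset.Icc (0 : ℤ) l) ×ˢ Finset.univ).filter fun f =>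
    ∀ v ∈ vertices f, 0 ≤ v.1 ∧ 0 ≤ v.2 ∧ v.1 + v.2 ≤ (l : ℤ)

/-- The bar `B(l)`, `l ≥ 1`: the triangle of side `l` without the triangle of side `l - 1` at its
top. It has `2 l - 1` faces; its larger base is the segment from `(0, 0)` to `(l, 0)`. -/
noncomputable def bar (l : ℕ) : Finset Face := triangle l \ (triangle (l - 1)).image (translate (0, 1))

/-- The quasi-regular hexagon `E_{B_i}(r)` in standard position, for `i ≤ 5`: bars are attached
along their larger bases to successive sides of `E(r)`, counter-clockwise from the top side, which
runs from `(-r, r)` to `(0, r)`. The first bar is a `B(r)`. Each bar lengthens the next side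
to `r + 1`, so that the following ones are `B(r + 1)`. (A sixth bar, `B(r + 2)`, would complete
`E(r + 1)`.) -/
noncomputable def quasiRegularHexagon (r : ℕ) : ℕ → Finset Face
  | 0 => regularHexagon r
  | i + 1 => quasiRegularHexagon r i ∪
      ((bar (if i = 0 then r else r + 1)).image (translate (-(r : ℤ), (r : ℤ)))).image (rotate^[i])

/-- The set of all quasi-regular hexagons: all translates and rotates of the `E_{B_i}(r)`, where
`r ≥ 1` and `0 ≤ i ≤ 5`. As `E_{B_6}(r) = E(r + 1)`, the value `i = 6` is covered. -/
def IsQuasiRegularHexagon (P : Finset Face) : Prop :=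
  ∃ r i : ℕ, 1 ≤ r ∧ i ≤ 5 ∧ Congruent (quasiRegularHexagon r i) P

end Polyiamond

/-!
A polyiamond `P` meets consecutive strips between lattice lines of each of the three directions. In
each of these strips, `P` has an empty face of the same strip beyond either end, where exactly one
of two neighbours belongs to `P`. By parity this happens to an empty face in at most two of its
three strips. Hence the site-perimeter of `P` is at least the sum `n` of its three widths, which are
the widths of the smallest hexagon containing `P`.

A hexagon with widths `m d` adding up to `n` has edge-perimeter at most `n`, and its area `A` is
given by `2 A = n² - s² - 2 ∑ d, m d ²`, where the difference `s` of the lengths of opposite sides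
has the parity of `n`. So `A` is largest for given `n` exactly when `|s| ≤ 1` and the widths differ
by at most one. Then it is at least `(n² - 7) / 6`, which exceeds the area `(n - 1)² / 6` that a
smaller sum of widths permits. Up to rotations and translations there is only one such hexagon, and
for `n = 6 r + i` with `i ≤ 5` this is `E_{B_i}(r)`.
-/

namespace Polyiamond

open Finset

/-! ### Strip coordinates -/

theorem sum_univ_fin_three_cyclic {M : Type*} [AddCommMonoid M] (a : Fin 3 → M) (d : Fin 3) :
    ∑ e, a e = a d + a (d + 1) + a (d + 2) := by
  rw [← Equiv.sum_comp (Equiv.addLeft d) a, Fin.sum_univ_three]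
  simp only [Equiv.coe_addLeft, add_zero]

/-- The barycentric coordinates `(x, y, -x - y)` of a vertex `(x, y)`. They put the three directions
of lattice lines on an equal footing: a lattice line is a line on which one of them is constant. -/
def vertexCoord (v : Vertex) : Fin 3 → ℤ := ![v.1, v.2, -v.1 - v.2]

/-- The strip coordinates of a face: the integer parts of the barycentric coordinates of its
interior points, so that the lattice lines of direction `d` through its vertices are those of
height `coord f d` and `coord f d + 1`. -/
def coord (f : Face) : Fin 3 → ℤ := ![f.1.1, f.1.2, -f.1.1 - f.1.2 - if f.2 then 1 else 2]

theorem coord_injective : Function.Injective coord := by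
  rintro ⟨⟨x, y⟩, b⟩ ⟨⟨x', y'⟩, b'⟩ h
  have h₀ : x = x' := congrFun h 0
  have h₁ : y = y' := congrFun h 1
  have h₂ := congrFun h 2
  cases b <;> cases b' <;> simp_all [coord]

theorem sum_coord (f : Face) : ∑ d, coord f d = if f.2 then -1 else -2 := by
  rw [Fin.sum_univ_three]
  simp only [coord, Matrix.cons_val]
  split_ifs <;> ring

theorem coord_add_coord_add_coord (f : Face) (d : Fin 3) :
    coord f d + coord f (d + 1) + coord f (d + 2) = if f.2 then -1 else -2 := by
  rw [← sum_univ_fin_three_cyclic, sum_coord]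

theorem sum_vertexCoord (v : Vertex) : ∑ d, vertexCoord v d = 0 := by
  rw [Fin.sum_univ_three]
  simp only [vertexCoord, Matrix.cons_val]
  ring

theorem mem_vertices {v : Vertex} {f : Face} :
    v ∈ vertices f ↔ ∀ d, coord f d ≤ vertexCoord v d ∧ vertexCoord v d ≤ coord f d + 1 := by
  obtain ⟨⟨x, y⟩, b⟩ := f
  obtain ⟨p, q⟩ := v
  cases b <;> simp [vertices, coord, vertexCoord, Fin.forall_fin_succ] <;> omega

theorem coord_rotate (f : Face) (d : Fin 3) : coord (rotate f) d = -1 - coord f (d + 1) := by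
  obtain ⟨⟨x, y⟩, b⟩ := f
  cases b <;> fin_cases d <;> simp [rotate, coord] <;> ring

theorem coord_translate (v : Vertex) (f : Face) :
    coord (translate v f) = coord f + vertexCoord v := by
  obtain ⟨⟨x, y⟩, b⟩ := f
  funext d
  cases b <;> fin_cases d <;> simp [translate, coord, vertexCoord] <;> ring

theorem eq_of_snd_eq_of_coord_eq {f g : Face} {d : Fin 3} (hb : f.2 = g.2)
    (h₀ : coord f d = coord g d) (h₁ : coord f (d + 1) = coord g (d + 1)) : f = g := by
  have h₂ : coord f (d + 2) = coord g (d + 2) := by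
    have hf := coord_add_coord_add_coord f d
    have hg := coord_add_coord_add_coord g d
    rw [hb] at hf
    omega
  refine coord_injective (funext fun e => ?_)
  obtain rfl | rfl | rfl : e = d ∨ e = d + 1 ∨ e = d + 2 := by
    fin_cases d <;> fin_cases e <;> decide
  exacts [h₀, h₁, h₂]

/-! ### Adjacent faces -/

/-- The face on the other side of the edge of `f` that lies on a lattice line of direction `d`. -/
def neighbor (d : Fin 3) : Face → Face
  | ((x, y), true) => ![((x - 1, y), false), ((x, y - 1), false), ((x, y), false)] d
  | ((x, y), false) => ![((x + 1, y), true), ((x, y + 1), true), ((x, y), true)] d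

theorem neighbor_snd (d : Fin 3) (f : Face) : (neighbor d f).2 = !f.2 := by
  obtain ⟨⟨x, y⟩, b⟩ := f
  cases b <;> fin_cases d <;> rfl

theorem neighbor_involutive (d : Fin 3) : Function.Involutive (neighbor d) := by
  rintro ⟨⟨x, y⟩, b⟩
  cases b <;> fin_cases d <;> simp [neighbor]

theorem neighbor_ne (d : Fin 3) (f : Face) : neighbor d f ≠ f := fun h => by
  simpa [neighbor_snd] using congrArg Prod.snd h

theorem coord_neighbor_self (d : Fin 3) (f : Face) :
    coord (neighbor d f) d = coord f d + if f.2 then -1 else 1 := by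
  obtain ⟨⟨x, y⟩, b⟩ := f
  cases b <;> fin_cases d <;> simp [neighbor, coord] <;> ring

theorem coord_neighbor_of_ne {d e : Fin 3} (h : e ≠ d) (f : Face) :
    coord (neighbor d f) e = coord f e := by
  obtain ⟨⟨x, y⟩, b⟩ := f
  cases b <;> fin_cases d <;> fin_cases e <;> simp [neighbor, coord] at h ⊢ <;> ring

/-- Two vertices of a face differ in exactly two barycentric coordinates, and these determine the
corresponding strip coordinates of the face. -/
theorem exists_eq_neighbor {f g : Face} {v w : Vertex} (hfg : f ≠ g) (hvw : v ≠ w)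
    (hvf : v ∈ vertices f) (hwf : w ∈ vertices f) (hvg : v ∈ vertices g) (hwg : w ∈ vertices g) :
    ∃ d, g = neighbor d f := by
  obtain ⟨⟨x, y⟩, b⟩ := f
  obtain ⟨⟨x', y'⟩, b'⟩ := g
  obtain ⟨p, q⟩ := v
  obtain ⟨p', q'⟩ := w
  cases b <;> cases b' <;>
    simp [mem_vertices, coord, vertexCoord, neighbor, Fin.forall_fin_succ,
      Fin.exists_fin_succ] at * <;> omega

/-- The common edge of `f` and `neighbor d f`. -/
def side (d : Fin 3) (f : Face) : Finset Vertex := vertices f ∩ vertices (neighbor d f)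

theorem card_side (d : Fin 3) (f : Face) : #(side d f) = 2 := by
  obtain ⟨⟨x, y⟩, b⟩ := f
  cases b <;> fin_cases d <;> simp [side, neighbor, vertices]

theorem side_mem_edges (d : Fin 3) (f : Face) : side d f ∈ edges f :=
  mem_powersetCard.2 ⟨inter_subset_left, card_side d f⟩

theorem side_mem_edges_neighbor (d : Fin 3) (f : Face) : side d f ∈ edges (neighbor d f) :=
  mem_powersetCard.2 ⟨inter_subset_right, card_side d f⟩

theorem exists_eq_neighbor_and_eq_side {f g : Face} {e : Finset Vertex} (hfg : f ≠ g)
    (hf : e ∈ edges f) (hg : e ∈ edges g) : ∃ d, g = neighbor d f ∧ e = side d f := by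
  rw [edges, mem_powersetCard] at hf hg
  obtain ⟨v, w, hvw, rfl⟩ := card_eq_two.1 hf.2
  simp only [insert_subset_iff, singleton_subset_iff] at hf hg
  obtain ⟨d, rfl⟩ := exists_eq_neighbor hfg hvw hf.1.1 hf.1.2 hg.1.1 hg.1.2
  refine ⟨d, rfl, eq_of_subset_of_card_le ?_ (by rw [card_side, hf.2])⟩
  simp only [side, insert_subset_iff, singleton_subset_iff, mem_inter]
  exact ⟨⟨hf.1.1, hg.1.1⟩, hf.1.2, hg.1.2⟩

theorem adj_iff_exists_eq_neighbor {f g : Face} : faceGraph.Adj f g ↔ ∃ d, g = neighbor d f := by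
  constructor
  · rintro ⟨hne, e, hf, hg⟩
    exact (exists_eq_neighbor_and_eq_side hne hf hg).imp fun _ => And.left
  · rintro ⟨d, rfl⟩
    exact ⟨(neighbor_ne d f).symm, side d f, side_mem_edges d f, side_mem_edges_neighbor d f⟩

/-- Adjacent faces point in opposite directions, so no three faces are pairwise adjacent. -/
theorem eq_of_shared_edge {f g g' : Face} {e : Finset Vertex} (hf : e ∈ edges f) (hg : e ∈ edges g)
    (hg' : e ∈ edges g') (hfg : f ≠ g) (hfg' : f ≠ g') : g = g' := by
  by_contra hne
  obtain ⟨d, rfl, -⟩ := exists_eq_neighbor_and_eq_side hfg hf hg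
  obtain ⟨d', rfl, -⟩ := exists_eq_neighbor_and_eq_side hfg' hf hg'
  obtain ⟨d'', h, -⟩ := exists_eq_neighbor_and_eq_side hne hg hg'
  simpa [neighbor_snd] using congrArg Prod.snd h

/-! ### Perimeters and strips -/

/-- The empty faces that share an edge with `P`, the ones that the site-perimeter counts. -/
def sites (P : Finset Face) : Finset Face := (univ.biUnion fun d => P.image (neighbor d)) \ P

theorem mem_sites {P : Finset Face} {g : Face} :
    g ∈ sites P ↔ g ∉ P ∧ ∃ d, neighbor d g ∈ P := by
  simp only [sites, mem_sdiff, mem_biUnion, mem_univ, true_and, mem_image,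
    (neighbor_involutive _).eq_iff, exists_eq_right, and_comm]

theorem sitePerimeter_eq_card_sites (P : Finset Face) : sitePerimeter P = #(sites P) := by
  rw [sitePerimeter, ← Set.ncard_coe_finset]
  congr 1
  ext g
  rw [Set.mem_ofPred_eq, mem_coe, mem_sites, and_congr_right_iff]
  refine fun _ => ⟨?_, fun ⟨d, hd⟩ => ⟨neighbor d g, hd, ?_⟩⟩
  · rintro ⟨f, hf, hfg⟩
    obtain ⟨d, rfl⟩ := adj_iff_exists_eq_neighbor.1 hfg
    exact ⟨d, (neighbor_involutive d f).symm ▸ hf⟩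
  · exact (adj_iff_exists_eq_neighbor.2 ⟨d, rfl⟩).symm

theorem boundary_subset_biUnion (P : Finset Face) :
    boundary P ⊆ ↑(univ.biUnion fun d => {f ∈ P | neighbor d f ∉ P}.image (side d)) := by
  rintro e ⟨f, hf, g, hg, hef, heg⟩
  obtain ⟨d, rfl, rfl⟩ := exists_eq_neighbor_and_eq_side (ne_of_mem_of_not_mem hf hg) hef heg
  exact mem_coe.2 (mem_biUnion.2 ⟨d, mem_univ d, mem_image_of_mem _ (mem_filter.2 ⟨hf, hg⟩)⟩)

theorem edgePerimeter_le_sum (P : Finset Face) :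
    edgePerimeter P ≤ ∑ d, #{f ∈ P | neighbor d f ∉ P} :=
  calc edgePerimeter P
      ≤ #(univ.biUnion fun d => {f ∈ P | neighbor d f ∉ P}.image (side d)) := by
        rw [← Set.ncard_coe_finset]
        exact Set.ncard_le_ncard (boundary_subset_biUnion P)
    _ ≤ ∑ d, #({f ∈ P | neighbor d f ∉ P}.image (side d)) := card_biUnion_le
    _ ≤ ∑ d, #{f ∈ P | neighbor d f ∉ P} := sum_le_sum fun _ _ => card_image_le

theorem sitePerimeter_le_edgePerimeter (P : Finset Face) : sitePerimeter P ≤ edgePerimeter P := by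
  have exists_direction (g : Face) : ∃ d, g ∈ sites P → neighbor d g ∈ P := by
    by_cases hg : g ∈ sites P
    · exact (mem_sites.1 hg).2.imp fun _ h _ => h
    · exact ⟨0, fun h => absurd h hg⟩
  choose direction neighbor_mem using exists_direction
  rw [sitePerimeter_eq_card_sites, ← Set.ncard_coe_finset]
  refine Set.ncard_le_ncard_of_injOn (fun g => side (direction g) g) ?_ ?_
    ((finite_toSet _).subset (boundary_subset_biUnion P))
  · exact fun g hg => ⟨_, neighbor_mem g hg, g, (mem_sites.1 hg).1,
      side_mem_edges_neighbor _ _, side_mem_edges _ _⟩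
  · intro g hg g' hg' (h : side (direction g) g = side (direction g') g')
    have hf := neighbor_mem g hg
    exact eq_of_shared_edge (side_mem_edges_neighbor _ _) (side_mem_edges _ _)
      (h ▸ side_mem_edges _ _) (ne_of_mem_of_not_mem hf (mem_sites.1 hg).1)
      (ne_of_mem_of_not_mem hf (mem_sites.1 hg').1)

theorem exists_two_steps_along_strip {e e' : Fin 3} (h : e ≠ e') (f : Face) :
    ∃ c c', (c = e ∧ c' = e' ∨ c = e' ∧ c' = e) ∧
      coord (neighbor c f) e - coord (neighbor c f) e' = coord f e - coord f e' + 1 ∧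
      coord (neighbor c' (neighbor c f)) e - coord (neighbor c' (neighbor c f)) e' =
        coord f e - coord f e' + 2 := by
  rcases hf : f.2
  · refine ⟨e, e', .inl ⟨rfl, rfl⟩, ?_, ?_⟩ <;>
      simp only [coord_neighbor_self, coord_neighbor_of_ne h, coord_neighbor_of_ne h.symm,
        neighbor_snd, hf, Bool.not_false, Bool.false_eq_true, if_true, if_false] <;> ring
  · refine ⟨e', e, .inr ⟨rfl, rfl⟩, ?_, ?_⟩ <;>
      simp only [coord_neighbor_self, coord_neighbor_of_ne h, coord_neighbor_of_ne h.symm,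
        neighbor_snd, hf, Bool.not_true, Bool.false_eq_true, if_true, if_false] <;> ring

/-- The face beyond the end of a strip: a face of `P` is on one side of it, none on the other. -/
theorem exists_notMem_beyond_strip {P : Finset Face} {d e e' : Fin 3} (hde : d ≠ e) (hde' : d ≠ e')
    (hee' : e ≠ e') {f : Face} (hf : f ∈ P) :
    ∃ g ∉ P, coord g d = coord f d ∧ ¬ (neighbor e g ∈ P ↔ neighbor e' g ∈ P) ∧
      ∀ f' ∈ P, coord f' d = coord f d → coord f' e - coord f' e' < coord g e - coord g e' := by
  obtain ⟨f₀, hf₀, hmax⟩ := exists_max_image {f' ∈ P | coord f' d = coord f d}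
    (fun f' => coord f' e - coord f' e') ⟨f, mem_filter.2 ⟨hf, rfl⟩⟩
  simp only [mem_filter, and_imp] at hf₀ hmax
  obtain ⟨c, c', hc, hstep, hstep'⟩ := exists_two_steps_along_strip hee' f₀
  have hdc : d ≠ c ∧ d ≠ c' := by aesop
  have hg : coord (neighbor c f₀) d = coord f d := by rw [coord_neighbor_of_ne hdc.1, hf₀.2]
  refine ⟨neighbor c f₀, fun h => ?_, hg, ?_, fun f' hf' hd => ?_⟩
  · linarith [hmax _ h hg]
  · have hf₀' : neighbor c (neighbor c f₀) ∈ P := by rw [neighbor_involutive c f₀]; exact hf₀.1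
    have hnext : neighbor c' (neighbor c f₀) ∉ P := fun h => by
      linarith [hmax _ h (by rw [coord_neighbor_of_ne hdc.2, hg])]
    aesop
  · linarith [hmax f' hf' hd]

theorem two_mul_card_image_coord_le (P : Finset Face) (d : Fin 3) :
    2 * #(P.image (coord · d)) ≤
      #{g ∈ sites P | ¬ (neighbor (d + 1) g ∈ P ↔ neighbor (d + 2) g ∈ P)} := by
  have hd₁ : d ≠ d + 1 := by fin_cases d <;> decide
  have hd₂ : d ≠ d + 2 := by fin_cases d <;> decide
  have hd₁₂ : d + 1 ≠ d + 2 := by fin_cases d <;> decide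
  refine mul_card_image_le_card_of_maps_to (f := (coord · d)) ?_ 2 ?_
  · intro g hg
    have hne := (mem_filter.1 hg).2
    by_cases hg₁ : neighbor (d + 1) g ∈ P
    · exact mem_image.2 ⟨_, hg₁, coord_neighbor_of_ne hd₁ g⟩
    · have hg₂ : neighbor (d + 2) g ∈ P := by tauto
      exact mem_image.2 ⟨_, hg₂, coord_neighbor_of_ne hd₂ g⟩
  · intro a ha
    obtain ⟨f, hf, rfl⟩ := mem_image.1 ha
    obtain ⟨g, hgP, hgd, hg, hbeyond⟩ := exists_notMem_beyond_strip hd₁ hd₂ hd₁₂ hf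
    obtain ⟨g', hgP', hgd', hg', hbeyond'⟩ := exists_notMem_beyond_strip hd₂ hd₁ hd₁₂.symm hf
    have hne : g ≠ g' := by
      rintro rfl
      linarith [hbeyond f hf rfl, hbeyond' f hf rfl]
    have mem_sites_of {g : Face} (hgP : g ∉ P)
        (hg : ¬ (neighbor (d + 1) g ∈ P ↔ neighbor (d + 2) g ∈ P)) : g ∈ sites P :=
      mem_sites.2 ⟨hgP, by by_contra! h; exact hg (by simp only [h])⟩
    refine one_lt_card.2 ⟨g, ?_, g', ?_, hne⟩ <;> simp only [mem_filter]
    · exact ⟨⟨mem_sites_of hgP hg, hg⟩, hgd⟩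
    · exact ⟨⟨mem_sites_of hgP' fun h => hg' h.symm, fun h => hg' h.symm⟩, hgd'⟩

theorem sum_card_image_coord_le_sitePerimeter (P : Finset Face) :
    ∑ d, #(P.image (coord · d)) ≤ sitePerimeter P := by
  rw [sitePerimeter_eq_card_sites]
  have two_directions (g : Face) :
      #{d | ¬ (neighbor (d + 1) g ∈ P ↔ neighbor (d + 2) g ∈ P)} ≤ 2 := by
    simp only [card_filter, Fin.sum_univ_three, Fin.reduceAdd]
    split_ifs <;> first | omega | tauto
  have h :=
    calc 2 * ∑ d, #(P.image (coord · d))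
        ≤ ∑ d, #{g ∈ sites P | ¬ (neighbor (d + 1) g ∈ P ↔ neighbor (d + 2) g ∈ P)} := by
          rw [mul_sum]
          exact sum_le_sum fun d _ => two_mul_card_image_coord_le P d
      _ = ∑ g ∈ sites P, #{d | ¬ (neighbor (d + 1) g ∈ P ↔ neighbor (d + 2) g ∈ P)} :=
          sum_card_bipartiteAbove_eq_sum_card_bipartiteBelow _
      _ ≤ #(sites P) * 2 := sum_le_card_nsmul _ _ _ fun g _ => two_directions g
  omega

/-! ### Hexagons -/

variable {l u l' u' : Fin 3 → ℤ}

/-- The faces lying, for each of the three directions `d`, between the lattice lines of heights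
`l d` and `u d`: the lattice hexagons, whose sides may have length zero. -/
noncomputable def hexagon (l u : Fin 3 → ℤ) : Finset Face :=
  (Fintype.piFinset fun d => Ico (l d) (u d)).preimage coord coord_injective.injOn

theorem mem_hexagon {f : Face} : f ∈ hexagon l u ↔ ∀ d, l d ≤ coord f d ∧ coord f d < u d := by
  simp only [hexagon, mem_preimage, Fintype.mem_piFinset, mem_Ico]

/-- The lines of height `l d` and `u d` all support `hexagon l u`: the side of `hexagon l u` on the
line of height `u d` has length `-(u d + l (d + 1) + l (d + 2))`, the one on the line of height
`l d` has length `l d + u (d + 1) + u (d + 2)`, and these lengths are not negative. -/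
def IsTight (l u : Fin 3 → ℤ) : Prop :=
  ∀ d, u d + l (d + 1) + l (d + 2) ≤ 0 ∧ 0 ≤ l d + u (d + 1) + u (d + 2)

theorem exists_neighbor_between {f g : Face} (h : f ≠ g) :
    ∃ d, (∀ e, coord (neighbor d f) e ∈ Set.uIcc (coord f e) (coord g e)) ∧
      ∑ e, (coord (neighbor d f) e - coord g e).natAbs < ∑ e, (coord f e - coord g e).natAbs := by
  obtain ⟨d, hd⟩ : ∃ d, if f.2 then coord g d < coord f d else coord f d < coord g d := by
    by_contra! hfg
    have hsum := sum_coord f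
    have hsum' := sum_coord g
    simp only [Fin.sum_univ_three] at hsum hsum'
    have h₀ := hfg 0
    have h₁ := hfg 1
    have h₂ := hfg 2
    refine h (coord_injective (funext fun d => ?_))
    fin_cases d <;> grind
  have hself := coord_neighbor_self d f
  have hother (e : Fin 3) (he : e ≠ d) := coord_neighbor_of_ne he f
  refine ⟨d, fun e => ?_, sum_lt_sum (fun e _ => ?_) ⟨d, mem_univ d, ?_⟩⟩
  · rw [Set.mem_uIcc]
    grind
  · grind
  · grind

theorem isPolyiamond_hexagon (hne : (hexagon l u).Nonempty) : IsPolyiamond (hexagon l u) := by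
  have reachable (n : ℕ) (f g : hexagon l u)
      (hn : ∑ e, (coord f.1 e - coord g.1 e).natAbs = n) :
      (faceGraph.induce (hexagon l u : Set Face)).Reachable f g := by
    induction n using Nat.strong_induction_on generalizing f with
    | _ n ih =>
      rcases eq_or_ne f.1 g.1 with hfg | hfg
      · rw [Subtype.ext hfg]
      · obtain ⟨d, hbetween, hcloser⟩ := exists_neighbor_between hfg
        have hmem : neighbor d f ∈ hexagon l u := mem_hexagon.2 fun e => by
          have hf := mem_hexagon.1 f.2 e
          have hg := mem_hexagon.1 g.2 e
          have := Set.mem_uIcc.1 (hbetween e)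
          omega
        have hadj : (faceGraph.induce (hexagon l u : Set Face)).Adj f ⟨neighbor d f, hmem⟩ :=
          adj_iff_exists_eq_neighbor.2 ⟨d, rfl⟩
        exact hadj.reachable.trans (ih _ (hn ▸ hcloser) ⟨_, hmem⟩ rfl)
  have : Nonempty (hexagon l u : Set Face) := hne.to_subtype
  exact ⟨fun f g => reachable _ f g rfl⟩

theorem ordConnected_range_of_adj {V : Type*} {G : SimpleGraph V} (hG : G.Preconnected)
    {c : V → ℤ} (hc : ∀ v w, G.Adj v w → c w ≤ c v + 1) : (Set.range c).OrdConnected := by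
  refine ⟨?_⟩
  rintro _ ⟨v, rfl⟩ _ ⟨w, rfl⟩ n ⟨hvn, hnw⟩
  obtain ⟨p⟩ := hG v w
  induction p with
  | nil => exact ⟨_, le_antisymm hvn hnw⟩
  | @cons v v' _ hadj _ ih =>
    rcases hvn.eq_or_lt with rfl | hlt
    · exact ⟨v, rfl⟩
    · exact ih ((hc v v' hadj).trans hlt) hnw

theorem coord_neighbor_le (d e : Fin 3) (f : Face) : coord (neighbor d f) e ≤ coord f e + 1 := by
  rcases eq_or_ne e d with rfl | h
  · rw [coord_neighbor_self]
    split_ifs <;> omega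
  · rw [coord_neighbor_of_ne h]
    omega

theorem Icc_subset_image_coord {P : Finset Face} (hP : IsPolyiamond P) {f g : Face} (hf : f ∈ P)
    (hg : g ∈ P) (d : Fin 3) : Icc (coord f d) (coord g d) ⊆ P.image (coord · d) := fun n hn => by
  have hconn := ordConnected_range_of_adj hP.preconnected (c := fun f => coord f.1 d) (by
    rintro ⟨f, _⟩ ⟨g, _⟩ hfg
    obtain ⟨e, rfl⟩ := adj_iff_exists_eq_neighbor.1 hfg
    exact coord_neighbor_le e d f)
  obtain ⟨⟨f', hf'⟩, rfl⟩ := hconn.out ⟨⟨f, hf⟩, rfl⟩ ⟨⟨g, hg⟩, rfl⟩ (mem_Icc.1 hn)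
  exact mem_image_of_mem _ hf'

theorem exists_hexagon_hull {P : Finset Face} (hP : IsPolyiamond P) :
    ∃ l u, IsTight l u ∧ P ⊆ hexagon l u ∧ ∑ d, (u d - l d) ≤ sitePerimeter P := by
  have hne : P.Nonempty := by obtain ⟨f, hf⟩ := hP.nonempty; exact ⟨f, hf⟩
  choose a haP ha using fun d => P.exists_min_image (coord · d) hne
  choose b hbP hb using fun d => P.exists_max_image (coord · d) hne
  refine ⟨fun d => coord (a d) d, fun d => coord (b d) d + 1, fun d => ⟨?_, ?_⟩, fun f hf => ?_, ?_⟩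
  · have h := coord_add_coord_add_coord (b d) d
    have := ha (d + 1) (b d) (hbP d)
    have := ha (d + 2) (b d) (hbP d)
    dsimp only
    split_ifs at h <;> omega
  · have h := coord_add_coord_add_coord (a d) d
    have := hb (d + 1) (a d) (haP d)
    have := hb (d + 2) (a d) (haP d)
    dsimp only
    split_ifs at h <;> omega
  · exact mem_hexagon.2 fun d => ⟨ha d f hf, Int.lt_add_one_iff.2 (hb d f hf)⟩
  · refine le_trans ?_ (Nat.cast_le.2 (sum_card_image_coord_le_sitePerimeter P))
    rw [Nat.cast_sum]
    refine sum_le_sum fun d _ => ?_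
    have := card_le_card (Icc_subset_image_coord hP (haP d) (hbP d) d)
    rw [Int.card_Icc] at this
    dsimp only
    omega

/-! ### Area and edge-perimeter of hexagons -/

/-- The upward triangle bounded by the lattice lines of heights `l d`. Its side length is
`-∑ d, l d`. -/
noncomputable def upTriangle (l : Fin 3 → ℤ) : Finset Face := hexagon l fun d => l d - ∑ e, l e

theorem mem_upTriangle {f : Face} : f ∈ upTriangle l ↔ ∀ d, l d ≤ coord f d := by
  refine mem_hexagon.trans ⟨fun h d => (h d).1, fun h d => ⟨h d, ?_⟩⟩
  have hsum := coord_add_coord_add_coord f d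
  rw [sum_univ_fin_three_cyclic l d]
  have h₁ := h (d + 1)
  have h₂ := h (d + 2)
  split_ifs at hsum <;> omega

/-- In the square of pairs `(p, q)` the upward faces fill the part `q ≤ p`, the downward faces the
part `p < q`. -/
theorem card_upTriangle (hl : ∑ d, l d ≤ 0) : (#(upTriangle l) : ℤ) = (∑ d, l d) ^ 2 := by
  set L := -∑ d, l d with hL
  have hsum : l 0 + l 1 + l 2 = -L := by rw [hL, neg_neg, Fin.sum_univ_three]
  have hcard : #(upTriangle l) = #(Ico 0 L ×ˢ Ico 0 L) := by
    refine card_nbij'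
      (fun f => if f.2 then (l 2 + L - 1 - coord f 2, coord f 0 - l 0)
        else (coord f 0 - l 0, l 2 + L - 1 - coord f 2))
      (fun p => if p.2 ≤ p.1 then ((l 0 + p.2, l 1 + p.1 - p.2), true)
        else ((l 0 + p.1, l 1 + p.2 - p.1 - 1), false)) ?_ ?_ ?_ ?_
    · rintro ⟨⟨x, y⟩, b⟩ hf
      have := mem_upTriangle.1 hf
      cases b <;> simp [coord, Fin.forall_fin_succ] at this ⊢ <;> omega
    · rintro ⟨p, q⟩ hpq
      simp only [coe_product, coe_Ico, Set.mem_prod, Set.mem_Ico] at hpq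
      refine mem_coe.2 (mem_upTriangle.2 ?_)
      dsimp only
      split_ifs <;> simp [coord, Fin.forall_fin_succ] <;> omega
    · rintro ⟨⟨x, y⟩, b⟩ hf
      have := mem_upTriangle.1 hf
      cases b <;> simp [coord, Fin.forall_fin_succ] at this ⊢ <;> grind
    · rintro ⟨p, q⟩ _
      by_cases hqp : q ≤ p <;> simp [coord, hqp] <;> omega
  rw [hcard, card_product, Int.card_Ico]
  push_cast
  rw [sub_zero, Int.toNat_of_nonneg (by omega), hL]
  ring

theorem IsTight.sum_lower_nonpos (h : IsTight l u) : ∑ d, l d ≤ 0 := by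
  rw [Fin.sum_univ_three]
  have h₀ := h 0
  have h₁ := h 1
  have h₂ := h 2
  simp only [Fin.reduceAdd] at h₀ h₁ h₂
  omega

theorem sum_update_fin_three (l : Fin 3 → ℤ) (d : Fin 3) (a : ℤ) :
    ∑ e, Function.update l d a e = a + l (d + 1) + l (d + 2) := by
  rw [sum_univ_fin_three_cyclic _ d]
  fin_cases d <;> simp

theorem upTriangle_sdiff_hexagon (h : ∀ d, l d ≤ u d) :
    upTriangle l \ hexagon l u = univ.biUnion fun d => upTriangle (Function.update l d (u d)) := by
  ext f
  simp only [mem_sdiff, mem_hexagon, mem_upTriangle, mem_biUnion, mem_univ, true_and,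
    Function.forall_update_iff l fun e a => a ≤ coord f e]
  constructor
  · rintro ⟨hl, hu⟩
    push Not at hu
    obtain ⟨d, hd⟩ := hu
    exact ⟨d, hd (hl d), fun e _ => hl e⟩
  · rintro ⟨d, hd, hl⟩
    refine ⟨fun e => ?_, fun hu => (hu d).2.not_ge hd⟩
    rcases eq_or_ne e d with rfl | he
    · exact (h e).trans hd
    · exact hl e he

theorem IsTight.le (h : IsTight l u) (d : Fin 3) : l d ≤ u d := by
  have h₀ := h 0
  have h₁ := h 1
  have h₂ := h 2
  fin_cases d <;> simp at h₀ h₁ h₂ ⊢ <;> omega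

theorem IsTight.disjoint_corners (h : IsTight l u) {d e : Fin 3} (hde : d ≠ e) :
    Disjoint (upTriangle (Function.update l d (u d))) (upTriangle (Function.update l e (u e))) := by
  refine disjoint_left.2 fun f hd he => ?_
  rw [mem_upTriangle, Function.forall_update_iff l fun e a => a ≤ coord f e] at hd he
  have hsum := sum_coord f
  have h₀ := h 0
  have h₁ := h 1
  have h₂ := h 2
  rw [Fin.sum_univ_three] at hsum
  fin_cases d <;> fin_cases e <;> simp [Fin.forall_fin_succ] at hde hd he h₀ h₁ h₂ <;> grind

theorem two_mul_card_hexagon (h : IsTight l u) :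
    2 * (#(hexagon l u) : ℤ) =
      (∑ d, (u d - l d)) ^ 2 - (∑ d, (l d + u d)) ^ 2 - 2 * ∑ d, (u d - l d) ^ 2 := by
  have hsub : hexagon l u ⊆ upTriangle l := fun f hf =>
    mem_upTriangle.2 fun d => (mem_hexagon.1 hf d).1
  have hcorners := congrArg card (upTriangle_sdiff_hexagon h.le)
  rw [card_sdiff_of_subset hsub,
    card_biUnion fun d _ e _ hde => h.disjoint_corners hde] at hcorners
  have hcorner (d : Fin 3) : (#(upTriangle (Function.update l d (u d))) : ℤ) =
      (u d + l (d + 1) + l (d + 2)) ^ 2 := by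
    rw [card_upTriangle, sum_update_fin_three]
    exact (sum_update_fin_three l d (u d)).trans_le (h d).1
  have hle := card_le_card hsub
  zify [hle] at hcorners
  simp only [card_upTriangle h.sum_lower_nonpos, hcorner, Fin.sum_univ_three, Fin.reduceAdd]
    at hcorners ⊢
  linear_combination -2 * hcorners

theorem coord_eq_of_neighbor_notMem_hexagon {d : Fin 3} {f : Face}
    (hf : f ∈ hexagon l u) (hfd : neighbor d f ∉ hexagon l u) :
    coord f d = if f.2 then l d else u d - 1 := by
  rw [mem_hexagon] at hf hfd
  push Not at hfd
  obtain ⟨e, he⟩ := hfd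
  have := hf e
  rcases eq_or_ne e d with rfl | hed
  · rw [coord_neighbor_self] at he
    grind
  · rw [coord_neighbor_of_ne hed] at he
    grind

/-- The edges on the line of height `l d` belong to upward faces, those on the line of height `u d`
to downward faces. -/
theorem card_filter_neighbor_notMem_hexagon_le (h : IsTight l u) (d : Fin 3) :
    (#{f ∈ hexagon l u | neighbor d f ∉ hexagon l u} : ℤ) ≤
      (l d + u (d + 1) + u (d + 2)) - (u d + l (d + 1) + l (d + 2)) := by
  let positions (b : Bool) : Finset ℤ :=
    if b then Ico (-l d - u (d + 2)) (u (d + 1)) else Ico (l (d + 1)) (-u d - l (d + 2))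
  have hcard : #{f ∈ hexagon l u | neighbor d f ∉ hexagon l u} ≤ #(univ.sigma positions) := by
    refine card_le_card_of_injOn (fun f => ⟨f.2, coord f (d + 1)⟩) ?_ ?_
    · intro f hf
      obtain ⟨hmem, hfd⟩ := mem_filter.1 hf
      have hd := coord_eq_of_neighbor_notMem_hexagon hmem hfd
      have hsum := coord_add_coord_add_coord f d
      have h₁ := mem_hexagon.1 hmem (d + 1)
      have h₂ := mem_hexagon.1 hmem (d + 2)
      cases hb : f.2 <;> simp [positions, hb] at hd hsum ⊢ <;> omega
    · intro f hf f' hf' hff'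
      obtain ⟨hmem, hfd⟩ := mem_filter.1 hf
      obtain ⟨hmem', hfd'⟩ := mem_filter.1 hf'
      obtain ⟨hb, h₁⟩ := Sigma.mk.inj hff'
      exact eq_of_snd_eq_of_coord_eq hb ((coord_eq_of_neighbor_notMem_hexagon hmem hfd).trans
        (hb ▸ (coord_eq_of_neighbor_notMem_hexagon hmem' hfd').symm)) (eq_of_heq h₁)
  simp only [card_sigma, Fintype.sum_bool, positions, if_true, Bool.false_eq_true, if_false,
    Int.card_Ico] at hcard
  have := h d
  omega

theorem edgePerimeter_hexagon_le (h : IsTight l u) :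
    edgePerimeter (hexagon l u) ≤ ∑ d, (u d - l d) :=
  calc (edgePerimeter (hexagon l u) : ℤ)
      ≤ ∑ d, (#{f ∈ hexagon l u | neighbor d f ∉ hexagon l u} : ℤ) :=
        mod_cast edgePerimeter_le_sum (hexagon l u)
    _ ≤ ∑ d, ((l d + u (d + 1) + u (d + 2)) - (u d + l (d + 1) + l (d + 2))) :=
        sum_le_sum fun d _ => card_filter_neighbor_notMem_hexagon_le h d
    _ = ∑ d, (u d - l d) := by
        simp only [Fin.sum_univ_three, Fin.reduceAdd]
        ring

/-! ### Balanced hexagons -/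

theorem mul_sub_succ_nonneg (b q : ℤ) : 0 ≤ (b - q) * (b - (q + 1)) := by
  rcases le_or_gt b q with h | h
  · exact mul_nonneg_of_nonpos_of_nonpos (by omega) (by omega)
  · exact mul_nonneg (by omega) (by omega)

theorem sum_mul_sub_succ_eq {ι : Type*} {s : Finset ι} {a b : ι → ℤ} {q : ℤ}
    (ha : ∀ i ∈ s, a i = q ∨ a i = q + 1) (hab : ∑ i ∈ s, a i = ∑ i ∈ s, b i) :
    ∑ i ∈ s, (b i - q) * (b i - (q + 1)) = ∑ i ∈ s, b i ^ 2 - ∑ i ∈ s, a i ^ 2 :=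
  calc ∑ i ∈ s, (b i - q) * (b i - (q + 1))
      = ∑ i ∈ s, (b i ^ 2 - a i ^ 2 + (2 * q + 1) * (a i - b i)) := sum_congr rfl fun i hi => by
        rcases ha i hi with h | h <;> rw [h] <;> ring
    _ = ∑ i ∈ s, b i ^ 2 - ∑ i ∈ s, a i ^ 2 := by
        rw [sum_add_distrib, sum_sub_distrib, ← mul_sum, sum_sub_distrib, hab, sub_self, mul_zero,
          add_zero]

theorem sum_sq_le_sum_sq_of_eq_or_eq_succ {ι : Type*} {s : Finset ι} {a b : ι → ℤ} {q : ℤ}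
    (ha : ∀ i ∈ s, a i = q ∨ a i = q + 1) (hab : ∑ i ∈ s, a i = ∑ i ∈ s, b i) :
    ∑ i ∈ s, a i ^ 2 ≤ ∑ i ∈ s, b i ^ 2 := by
  rw [← sub_nonneg, ← sum_mul_sub_succ_eq ha hab]
  exact sum_nonneg fun i _ => mul_sub_succ_nonneg (b i) q

theorem eq_or_eq_succ_of_sum_sq_le {ι : Type*} {s : Finset ι} {a b : ι → ℤ} {q : ℤ}
    (ha : ∀ i ∈ s, a i = q ∨ a i = q + 1) (hab : ∑ i ∈ s, a i = ∑ i ∈ s, b i)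
    (hle : ∑ i ∈ s, b i ^ 2 ≤ ∑ i ∈ s, a i ^ 2) : ∀ i ∈ s, b i = q ∨ b i = q + 1 := by
  have hzero : ∑ i ∈ s, (b i - q) * (b i - (q + 1)) = 0 := by
    rw [sum_mul_sub_succ_eq ha hab, sub_eq_zero]
    exact le_antisymm hle (sum_sq_le_sum_sq_of_eq_or_eq_succ ha hab)
  intro i hi
  have := (sum_eq_zero_iff_of_nonneg fun i _ => mul_sub_succ_nonneg (b i) q).1 hzero i hi
  simpa only [mul_eq_zero, sub_eq_zero] using this

/-- The bounds of a hexagon that is as close to regular as its perimeter permits: the lengths of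
opposite sides, whose difference is `∑ d, (l d + u d)` in all three directions, differ by at most
one, and so do the widths of the hexagon in the three directions. -/
structure IsBalanced (l u : Fin 3 → ℤ) : Prop where
  abs_skew_le : |∑ d, (l d + u d)| ≤ 1
  exists_width_eq : ∃ q, ∀ d, u d - l d = q ∨ u d - l d = q + 1

theorem IsBalanced.isTight (h : IsBalanced l u) (hn : 4 ≤ ∑ d, (u d - l d)) : IsTight l u := by
  obtain ⟨hs, q, hq⟩ := h
  have h₀ := hq 0
  have h₁ := hq 1
  have h₂ := hq 2
  rw [abs_le] at hs
  simp only [Fin.sum_univ_three] at hn hs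
  intro d
  fin_cases d <;> simp <;> omega

theorem six_mul_card_hexagon_le (h : IsTight l u) :
    6 * (#(hexagon l u) : ℤ) ≤ (∑ d, (u d - l d)) ^ 2 := by
  have hcard := two_mul_card_hexagon h
  have hsq := sq_sum_le_card_mul_sum_sq (s := univ) (f := fun d => u d - l d)
  rw [card_univ, Fintype.card_fin] at hsq
  push_cast at hsq
  linarith [sq_nonneg (∑ d, (l d + u d))]

theorem IsBalanced.le_six_mul_card_hexagon (h : IsBalanced l u) (hn : 4 ≤ ∑ d, (u d - l d)) :
    (∑ d, (u d - l d)) ^ 2 - 7 ≤ 6 * (#(hexagon l u) : ℤ) := by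
  have hcard := two_mul_card_hexagon (h.isTight hn)
  have hskew : (∑ d, (l d + u d)) ^ 2 ≤ 1 := (sq_le_one_iff_abs_le_one _).2 h.abs_skew_le
  have hwidth : 3 * ∑ d, (u d - l d) ^ 2 ≤ (∑ d, (u d - l d)) ^ 2 + 2 := by
    obtain ⟨q, hq⟩ := h.exists_width_eq
    simp only [Fin.sum_univ_three]
    rcases hq 0 with h₀ | h₀ <;> rcases hq 1 with h₁ | h₁ <;> rcases hq 2 with h₂ | h₂ <;>
      rw [h₀, h₁, h₂] <;> nlinarith
  linarith

theorem sum_width_le_of_card_hexagon_le (h : IsTight l u) (h' : IsBalanced l' u')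
    (hn' : 5 ≤ ∑ d, (u' d - l' d))
    (hle : #(hexagon l' u') ≤ #(hexagon l u)) : ∑ d, (u' d - l' d) ≤ ∑ d, (u d - l d) := by
  by_contra! hlt
  have hupper := six_mul_card_hexagon_le h
  have hlower := h'.le_six_mul_card_hexagon (by omega)
  have hnonneg : 0 ≤ ∑ d, (u d - l d) := sum_nonneg fun d _ => sub_nonneg.2 (h.le d)
  have hsq : (∑ d, (u d - l d)) ^ 2 ≤ (∑ d, (u' d - l' d) - 1) ^ 2 :=
    pow_le_pow_left₀ hnonneg (by omega) 2
  zify at hle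
  linarith

theorem IsBalanced.sq_skew_le (h' : IsBalanced l' u') (hn : ∑ d, (u d - l d) = ∑ d, (u' d - l' d)) :
    (∑ d, (l' d + u' d)) ^ 2 ≤ (∑ d, (l d + u d)) ^ 2 := by
  have hskew' := h'.abs_skew_le
  rw [sq_le_sq]
  simp only [sum_add_distrib, sum_sub_distrib] at hn hskew' ⊢
  grind

theorem card_hexagon_le_of_isBalanced (h : IsTight l u) (h' : IsBalanced l' u')
    (hn : ∑ d, (u d - l d) = ∑ d, (u' d - l' d))
    (hn' : 4 ≤ ∑ d, (u' d - l' d)) : #(hexagon l u) ≤ #(hexagon l' u') := by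
  obtain ⟨q, hq⟩ := h'.exists_width_eq
  have hcard := two_mul_card_hexagon h
  have hcard' := two_mul_card_hexagon (h'.isTight hn')
  have hskew := h'.sq_skew_le hn
  have hwidth := sum_sq_le_sum_sq_of_eq_or_eq_succ (fun d _ => hq d) hn.symm
  rw [hn] at hcard
  zify
  linarith

theorem isBalanced_of_card_hexagon_le (h : IsTight l u) (h' : IsBalanced l' u')
    (hn : ∑ d, (u d - l d) = ∑ d, (u' d - l' d))
    (hn' : 4 ≤ ∑ d, (u' d - l' d)) (hle : #(hexagon l' u') ≤ #(hexagon l u)) : IsBalanced l u := by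
  obtain ⟨q, hq⟩ := h'.exists_width_eq
  have hcard := two_mul_card_hexagon h
  have hcard' := two_mul_card_hexagon (h'.isTight hn')
  have hskew := h'.sq_skew_le hn
  have hskew' : (∑ d, (l' d + u' d)) ^ 2 ≤ 1 := (sq_le_one_iff_abs_le_one _).2 h'.abs_skew_le
  have hwidth := sum_sq_le_sum_sq_of_eq_or_eq_succ (fun d _ => hq d) hn.symm
  rw [hn] at hcard
  zify at hle
  refine ⟨(sq_le_one_iff_abs_le_one _).1 (by linarith), q, fun d => ?_⟩
  exact eq_or_eq_succ_of_sum_sq_le (fun d _ => hq d) hn.symm (by linarith) d (mem_univ d)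

/-! ### Symmetries -/

theorem image_eq_of_forall_mem_iff {α β : Type*} [DecidableEq β] {φ : α → β} (hφ : φ.Surjective)
    {s : Finset α} {t : Finset β} (h : ∀ a, φ a ∈ t ↔ a ∈ s) : s.image φ = t := by
  ext b
  obtain ⟨a, rfl⟩ := hφ b
  exact ⟨fun hb => by obtain ⟨a', ha', hφa⟩ := mem_image.1 hb; exact hφa ▸ (h a').2 ha',
    fun hb => mem_image_of_mem φ ((h a).1 hb)⟩

theorem translate_surjective (v : Vertex) : Function.Surjective (translate v) := fun f =>
  ⟨translate (-v) f, Prod.ext (neg_add_cancel_right f.1 v) rfl⟩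

theorem sum_comp_add_right {G M : Type*} [AddGroup G] [Fintype G] [AddCommMonoid M] (a : G → M)
    (c : G) : ∑ d, a (d + c) = ∑ d, a d :=
  Equiv.sum_comp (Equiv.addRight c) a

theorem rotate_iterate_six (f : Face) : rotate^[6] f = f := by
  obtain ⟨⟨x, y⟩, b⟩ := f
  cases b <;> simp [rotate] <;> omega

theorem rotate_surjective : Function.Surjective rotate := fun f =>
  ⟨rotate^[5] f, rotate_iterate_six f⟩

theorem image_translate_hexagon (v : Vertex) (l u : Fin 3 → ℤ) :
    (hexagon l u).image (translate v) = hexagon (l + vertexCoord v) (u + vertexCoord v) :=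
  image_eq_of_forall_mem_iff (translate_surjective v) fun f => by
    simp only [mem_hexagon, coord_translate, Pi.add_apply, add_le_add_iff_right,
      add_lt_add_iff_right]

theorem image_rotate_hexagon (l u : Fin 3 → ℤ) :
    (hexagon l u).image rotate = hexagon (fun d => -u (d + 1)) (fun d => -l (d + 1)) :=
  image_eq_of_forall_mem_iff rotate_surjective fun f => by
    rw [mem_hexagon, mem_hexagon,
      ← (Equiv.addRight (1 : Fin 3)).forall_congr_right (q := fun d => l d ≤ _ ∧ _ < u d)]
    refine forall_congr' fun d => ?_
    simp only [coord_rotate, Equiv.coe_addRight]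
    omega

theorem image_rotate_iterate_three_hexagon (l u : Fin 3 → ℤ) :
    (hexagon l u).image (rotate^[3]) = hexagon (-u) (-l) := by
  simp only [Function.iterate_succ, Function.iterate_zero, ← image_image, image_id,
    image_rotate_hexagon, neg_neg]
  congr 1 <;> funext d <;> fin_cases d <;> rfl

theorem image_rotate_iterate_four_hexagon (l u : Fin 3 → ℤ) :
    (hexagon l u).image (rotate^[4]) = hexagon (fun d => l (d + 1)) (fun d => u (d + 1)) := by
  rw [Function.iterate_succ', ← image_image, image_rotate_iterate_three_hexagon,
    image_rotate_hexagon]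
  simp only [Pi.neg_apply, neg_neg]

theorem image_rotate_iterate_four_mul_hexagon (c : Fin 3) (l u : Fin 3 → ℤ) :
    (hexagon l u).image (rotate^[4 * c]) = hexagon (fun d => l (d + c)) (fun d => u (d + c)) := by
  rw [Function.iterate_mul]
  match c with
  | 0 => simp
  | 1 => exact image_rotate_iterate_four_hexagon l u
  | 2 =>
    change image (rotate^[4] ∘ rotate^[4]) (hexagon l u) = _
    rw [← image_image, image_rotate_iterate_four_hexagon, image_rotate_iterate_four_hexagon]
    simp only [add_assoc, Fin.reduceAdd]

theorem exists_image_translate_hexagon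
    (hwidth : ∀ d, u' d - l' d = u d - l d) (hsum : ∑ d, l' d = ∑ d, l d) :
    ∃ v, (hexagon l u).image (translate v) = hexagon l' u' := by
  refine ⟨(l' 0 - l 0, l' 1 - l 1), ?_⟩
  have hv : l + vertexCoord (l' 0 - l 0, l' 1 - l 1) = l' := by
    simp only [Fin.sum_univ_three] at hsum
    funext d
    fin_cases d <;> simp [vertexCoord]; omega
  have hv' : u + vertexCoord (l' 0 - l 0, l' 1 - l 1) = u' := by
    funext d
    have := congrFun hv d
    have := hwidth d
    simp only [Pi.add_apply] at *
    omega
  rw [image_translate_hexagon, hv, hv']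

theorem exists_shift_of_eq_or_eq_succ {m m' : Fin 3 → ℤ} {q q' : ℤ}
    (hm : ∀ d, m d = q ∨ m d = q + 1) (hm' : ∀ d, m' d = q' ∨ m' d = q' + 1)
    (h : ∑ d, m' d = ∑ d, m d) : ∃ c, ∀ d, m' d = m (d + c) := by
  simp only [Fin.sum_univ_three, Fin.forall_fin_succ, Fin.exists_fin_succ] at *
  simp only [Fin.isValue, add_zero, Fin.succ_zero_eq_one, Fin.succ_one_eq_two, IsEmpty.forall_iff,
    and_true, zero_add, Fin.reduceAdd, IsEmpty.exists_iff, or_false] at *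
  rcases hm with ⟨h₀ | h₀, h₁ | h₁, h₂ | h₂⟩ <;>
    rcases hm' with ⟨h₀' | h₀', h₁' | h₁', h₂' | h₂'⟩ <;> omega

theorem IsBalanced.congruent (h : IsBalanced l u) (h' : IsBalanced l' u')
    (hn : ∑ d, (u' d - l' d) = ∑ d, (u d - l d)) :
    Congruent (hexagon l u) (hexagon l' u') := by
  obtain ⟨q, hq⟩ := h.exists_width_eq
  obtain ⟨q', hq'⟩ := h'.exists_width_eq
  obtain ⟨c, hc⟩ := exists_shift_of_eq_or_eq_succ hq hq' hn
  have hskew := abs_le.1 h.abs_skew_le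
  have hskew' := abs_le.1 h'.abs_skew_le
  simp only [sum_add_distrib, sum_sub_distrib] at hn hskew hskew'
  obtain hl | hl : ∑ d, l' d = ∑ d, l d ∨ ∑ d, l' d = -∑ d, u d := by omega
  · obtain ⟨v, hv⟩ := exists_image_translate_hexagon hc (hl.trans (sum_comp_add_right l c).symm)
    refine ⟨4 * c, v, ?_⟩
    rw [image_rotate_iterate_four_mul_hexagon, hv]
  · -- A half turn changes the sign of the skew.
    obtain ⟨v, hv⟩ := exists_image_translate_hexagon
      (l := fun d => (-u) (d + c)) (u := fun d => (-l) (d + c)) (l' := l') (u' := u')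
      (fun d => by rw [hc, Pi.neg_apply, Pi.neg_apply]; ring)
      (by rw [sum_comp_add_right (-u), hl]; simp only [Pi.neg_apply, sum_neg_distrib])
    refine ⟨4 * c + 3, v, ?_⟩
    rw [Function.iterate_add, ← image_image, image_rotate_iterate_three_hexagon,
      image_rotate_iterate_four_mul_hexagon, hv]

/-! ### Perimeters of balanced hexagons -/

theorem IsBalanced.translate (h : IsBalanced l u) (v : Vertex) :
    IsBalanced (l + vertexCoord v) (u + vertexCoord v) where
  abs_skew_le := by
    simpa only [Pi.add_apply, sum_add_distrib, sum_vertexCoord, add_zero] using h.abs_skew_le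
  exists_width_eq := by simpa only [Pi.add_apply, add_sub_add_right_eq_sub] using h.exists_width_eq

theorem IsBalanced.rotate (h : IsBalanced l u) :
    IsBalanced (fun d => -u (d + 1)) (fun d => -l (d + 1)) where
  abs_skew_le := by
    rw [sum_comp_add_right (fun d => -u d + -l d), ← abs_neg, ← sum_neg_distrib]
    simpa only [neg_add, neg_neg, add_comm] using h.abs_skew_le
  exists_width_eq := by
    obtain ⟨q, hq⟩ := h.exists_width_eq
    exact ⟨q, fun d => by simpa only [neg_sub_neg] using hq (d + 1)⟩

/-- `P` is a hexagon with balanced bounds whose three widths add up to `n`; for `5 ≤ n`, this sum is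
both the edge-perimeter and the site-perimeter of `P`. -/
def IsBalancedHexagon (n : ℕ) (P : Finset Face) : Prop :=
  ∃ l u, IsBalanced l u ∧ ∑ d, (u d - l d) = n ∧ hexagon l u = P

namespace IsBalancedHexagon

variable {n : ℕ} {E P : Finset Face}

theorem image_translate (hP : IsBalancedHexagon n P) (v : Vertex) :
    IsBalancedHexagon n (P.image (translate v)) := by
  obtain ⟨l, u, h, hn, rfl⟩ := hP
  refine ⟨_, _, h.translate v, ?_, (image_translate_hexagon v l u).symm⟩
  simpa only [Pi.add_apply, add_sub_add_right_eq_sub] using hn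

theorem image_rotate (hP : IsBalancedHexagon n P) : IsBalancedHexagon n (P.image rotate) := by
  obtain ⟨l, u, h, hn, rfl⟩ := hP
  refine ⟨_, _, h.rotate, ?_, (image_rotate_hexagon l u).symm⟩
  rw [sum_comp_add_right fun d => -l d - -u d]
  simpa only [neg_sub_neg] using hn

theorem image_rotate_iterate (hP : IsBalancedHexagon n P) (z : ℕ) :
    IsBalancedHexagon n (P.image rotate^[z]) := by
  induction z with
  | zero => simpa only [Function.iterate_zero, image_id] using hP
  | succ z ih => simpa only [Function.iterate_succ', ← image_image] using ih.image_rotate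

theorem of_congruent (hE : IsBalancedHexagon n E) (h : Congruent E P) : IsBalancedHexagon n P := by
  obtain ⟨z, v, rfl⟩ := h
  exact (hE.image_rotate_iterate z).image_translate v

theorem congruent (hE : IsBalancedHexagon n E) (hP : IsBalancedHexagon n P) : Congruent E P := by
  obtain ⟨l, u, h, hn, rfl⟩ := hE
  obtain ⟨l', u', h', hn', rfl⟩ := hP
  exact h.congruent h' (hn'.trans hn.symm)

theorem isPolyiamond (hE : IsBalancedHexagon n E) (hn : 4 ≤ n) : IsPolyiamond E := by
  obtain ⟨l, u, h, hsum, rfl⟩ := hE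
  have hcard := h.le_six_mul_card_hexagon (by omega)
  rw [hsum] at hcard
  exact isPolyiamond_hexagon (card_pos.1 (by zify at hn ⊢; nlinarith))

theorem edgePerimeter_le (hE : IsBalancedHexagon n E) (hn : 4 ≤ n) : edgePerimeter E ≤ n := by
  obtain ⟨l, u, h, hsum, rfl⟩ := hE
  have := edgePerimeter_hexagon_le (h.isTight (by omega))
  omega

theorem le_sitePerimeter (hE : IsBalancedHexagon n E) (hn : 5 ≤ n) (hP : IsPolyiamond P)
    (harea : area E ≤ area P) : n ≤ sitePerimeter P := by
  obtain ⟨l, u, h, hsum, rfl⟩ := hE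
  obtain ⟨l', u', htight, hPsub, hsite⟩ := exists_hexagon_hull hP
  have := sum_width_le_of_card_hexagon_le htight h (by omega) (harea.trans (card_le_card hPsub))
  omega

theorem of_sitePerimeter_le (hE : IsBalancedHexagon n E) (hn : 5 ≤ n) (hP : IsPolyiamond P)
    (harea : area E ≤ area P) (hle : sitePerimeter P ≤ n) : IsBalancedHexagon n P := by
  obtain ⟨l, u, h, hsum, rfl⟩ := hE
  obtain ⟨l', u', htight, hPsub, hsite⟩ := exists_hexagon_hull hP
  have hcard := harea.trans (card_le_card hPsub)
  have hwidth := sum_width_le_of_card_hexagon_le htight h (by omega) hcard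
  have hsum' : ∑ d, (u' d - l' d) = ∑ d, (u d - l d) := by omega
  have hPeq : P = hexagon l' u' := eq_of_subset_of_card_le hPsub
    ((card_hexagon_le_of_isBalanced htight h hsum' (by omega)).trans harea)
  exact ⟨l', u', isBalanced_of_card_hexagon_le htight h hsum' (by omega) hcard,
    hsum'.trans hsum, hPeq.symm⟩

theorem edgePerimeter_eq (hE : IsBalancedHexagon n E) (hn : 5 ≤ n) : edgePerimeter E = n :=
  (hE.edgePerimeter_le (by omega)).antisymm
    ((hE.le_sitePerimeter hn (hE.isPolyiamond (by omega)) le_rfl).trans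
      (sitePerimeter_le_edgePerimeter E))

theorem sitePerimeter_eq (hE : IsBalancedHexagon n E) (hn : 5 ≤ n) : sitePerimeter E = n :=
  ((sitePerimeter_le_edgePerimeter E).trans (hE.edgePerimeter_le (by omega))).antisymm
    (hE.le_sitePerimeter hn (hE.isPolyiamond (by omega)) le_rfl)

end IsBalancedHexagon

/-! ### Quasi-regular hexagons are the balanced ones -/

theorem regularHexagon_eq_hexagon (r : ℕ) :
    regularHexagon r = hexagon (fun _ => -r) (fun _ => r) := by
  ext ⟨⟨x, y⟩, b⟩
  rw [regularHexagon, mem_filter, mem_hexagon]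
  cases b <;> simp [vertices, coord, Fin.forall_fin_succ, abs_le] <;> omega

theorem mem_triangle {k : ℕ} {f : Face} :
    f ∈ triangle k ↔ 0 ≤ coord f 0 ∧ 0 ≤ coord f 1 ∧ -k ≤ coord f 2 := by
  obtain ⟨⟨x, y⟩, b⟩ := f
  rw [triangle, mem_filter]
  cases b <;> simp [vertices, coord] <;> omega

theorem bar_eq_hexagon {k : ℕ} (hk : 1 ≤ k) : bar k = hexagon ![0, 0, -k] ![k, 1, 0] := by
  have htop : (triangle (k - 1)).image (translate (0, 1)) = upTriangle ![0, 1, -k] :=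
    image_eq_of_forall_mem_iff (translate_surjective _) fun f => by
      simp only [mem_triangle, mem_upTriangle, coord_translate, vertexCoord, Fin.forall_fin_succ,
        Pi.add_apply, Fin.succ_zero_eq_one, Fin.succ_one_eq_two, Matrix.cons_val,
        IsEmpty.forall_iff, and_true]
      omega
  ext f
  have hsum := sum_coord f
  rw [bar, htop, mem_sdiff, mem_triangle, mem_upTriangle, mem_hexagon]
  simp only [Fin.forall_fin_succ, Fin.sum_univ_three, Fin.succ_zero_eq_one, Fin.succ_one_eq_two,
    Matrix.cons_val, IsEmpty.forall_iff] at hsum ⊢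
  grind

theorem quasiRegularHexagon_eq_hexagon {r i : ℕ} (hr : 1 ≤ r) (hi : i ≤ 5) :
    quasiRegularHexagon r i = hexagon
      ![-r - if 2 ≤ i then 1 else 0, -r - if 4 ≤ i then 1 else 0, -r]
      ![r + if 5 ≤ i then 1 else 0, r + if 1 ≤ i then 1 else 0, r + if 3 ≤ i then 1 else 0] := by
  induction i with
  | zero =>
    rw [quasiRegularHexagon, regularHexagon_eq_hexagon]
    congr 1 <;> funext d <;> fin_cases d <;> simp
  | succ i ih =>
    have hi' : i ≤ 4 := by omega
    rw [quasiRegularHexagon, ih (by omega), bar_eq_hexagon (by split_ifs <;> omega),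
      image_translate_hexagon]
    ext f
    have hsum := sum_coord f
    rw [Fin.sum_univ_three] at hsum
    interval_cases i <;>
      simp only [Function.iterate_succ, Function.iterate_zero, ← image_image, image_id,
        image_rotate_hexagon, mem_union, mem_hexagon] <;>
      simp [Fin.forall_fin_succ, vertexCoord] <;> grind

theorem isBalancedHexagon_quasiRegularHexagon {r i : ℕ} (hr : 1 ≤ r) (hi : i ≤ 5) :
    IsBalancedHexagon (6 * r + i) (quasiRegularHexagon r i) := by
  refine ⟨_, _, ⟨?_, 2 * r + (i / 3 : ℕ), fun d => ?_⟩, ?_,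
    (quasiRegularHexagon_eq_hexagon hr hi).symm⟩
  · rw [Fin.sum_univ_three]
    interval_cases i <;> simp [abs_le] <;> omega
  · interval_cases i <;> fin_cases d <;> simp <;> omega
  · rw [Fin.sum_univ_three]
    interval_cases i <;> simp <;> omega

theorem isQuasiRegularHexagon_iff {P : Finset Face} :
    IsQuasiRegularHexagon P ↔ ∃ n ≥ 6, IsBalancedHexagon n P := by
  constructor
  · rintro ⟨r, i, hr, hi, h⟩
    exact ⟨6 * r + i, by omega, (isBalancedHexagon_quasiRegularHexagon hr hi).of_congruent h⟩
  · rintro ⟨n, hn, hP⟩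
    have h := isBalancedHexagon_quasiRegularHexagon (r := n / 6) (i := n % 6) (by omega) (by omega)
    rw [Nat.div_add_mod] at h
    exact ⟨n / 6, n % 6, by omega, by omega, h.congruent hP⟩

end Polyiamond

theorem mainTheorem9 (E : Finset Polyiamond.Face) (hE : Polyiamond.IsQuasiRegularHexagon E) :
    (∀ P : Finset Polyiamond.Face, Polyiamond.IsPolyiamond P →
      ¬ Polyiamond.IsQuasiRegularHexagon P → Polyiamond.area E ≤ Polyiamond.area P →
      Polyiamond.edgePerimeter E < Polyiamond.edgePerimeter P ∧
      Polyiamond.sitePerimeter E < Polyiamond.sitePerimeter P) ∧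
    Polyiamond.IsPolyiamond E ∧
    (∀ P : Finset Polyiamond.Face, Polyiamond.IsPolyiamond P →
      Polyiamond.area P = Polyiamond.area E →
      Polyiamond.edgePerimeter E ≤ Polyiamond.edgePerimeter P ∧
      (Polyiamond.edgePerimeter P = Polyiamond.edgePerimeter E ↔ Polyiamond.Congruent E P) ∧
      Polyiamond.sitePerimeter E ≤ Polyiamond.sitePerimeter P ∧
      (Polyiamond.sitePerimeter P = Polyiamond.sitePerimeter E ↔ Polyiamond.Congruent E P)) := by
  obtain ⟨n, hn, hE⟩ := Polyiamond.isQuasiRegularHexagon_iff.1 hE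
  have hn' : 5 ≤ n := by omega
  rw [hE.edgePerimeter_eq hn', hE.sitePerimeter_eq hn']
  refine ⟨fun P hP hPquasi harea => ?_, hE.isPolyiamond (by omega), fun P hP harea => ?_⟩
  · have hlt : n < Polyiamond.sitePerimeter P := lt_of_not_ge fun hle =>
      hPquasi (Polyiamond.isQuasiRegularHexagon_iff.2
        ⟨n, hn, hE.of_sitePerimeter_le hn' hP harea hle⟩)
    exact ⟨hlt.trans_le (Polyiamond.sitePerimeter_le_edgePerimeter P), hlt⟩
  · have hle := hE.le_sitePerimeter hn' hP harea.ge
    have hle_edge := Polyiamond.sitePerimeter_le_edgePerimeter P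
    have congruent_of_le (h : Polyiamond.sitePerimeter P ≤ n) : Polyiamond.Congruent E P :=
      hE.congruent (hE.of_sitePerimeter_le hn' hP harea.ge h)
    exact ⟨hle.trans hle_edge,
      ⟨fun h => congruent_of_le (hle_edge.trans h.le),
        fun h => (hE.of_congruent h).edgePerimeter_eq hn'⟩,
      hle,
      ⟨fun h => congruent_of_le h.le, fun h => (hE.of_congruent h).sitePerimeter_eq hn'⟩⟩
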